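/- A \emph{contact relation} on a Boolean algebra $B$ (in which $0=1$ is allowed; complement is written ${}^*$) is a binary relation $\rho$ on $B$ such that (C1) $a\neq 0$ implies $a\rho a$; (C2) $a\rho b$ implies $a\neq 0\neq b$; (C3) $a\rho b$ implies $b\rho a$; (C4) $a\rho(b\vee c)$ iff $a\rho b$ or $a\rho c$. Write $a\ll_\rho b$ iff not $a\rho b^*$. A \emph{local contact algebra} $(B,\rho,\mathbb B)$ is a Boolean algebra $B$ with a contact relation $\rho$ and a subset $\mathbb B\subseteq B$ such that: $0\in\mathbb B$; $a\le b\in\mathbb B$ implies $a\in\mathbb B$; $a,b\in\mathbb B$ implies $a\vee b\in\mathbb B$; if $a\in\mathbb B$ and $a\ll_\rho c$ then $a\ll_\rho b\ll_\rho c$ for some $b\in\mathbb B$; if $a\rho b$ then $a\rho(c\wedge b)$ for some $c\in\mathbb B$; if $a\ne 0$ then $b\ll_\rho a$ for some $b\in\mathbb B\setminus\{0\}$. It is \emph{complete} if $B$ is a complete Boolean algebra. An \emph{MVD-algebra} $(B,\le,\ll)$ is a Boolean algebra $(B,\le)$ with a binary relation $\ll$ such that: $a\ll b$ implies $a\le b$;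 $0\ll 0$; $a\le b\ll c\le t$ implies $a\ll t$; $a\ll c$ and $b\ll c$ imply $a\vee b\ll c$; $a\ll c$ implies $a\ll b\ll c$ for some $b$; if $a\ne0$ then $b\ll a$ for some $b\neq 0$; $a\ll b$ and $a\ll c$ imply $a\ll b\wedge c$; if $a\ll 1$ and $b^*\ll a^*$ then $a\ll b$. It is \emph{complete} if $(B,\le)$ is a complete Boolean algebra. For a complete Boolean homomorphism $\varphi:A\to B$ between complete Boolean algebras, let $\varphi_\Lambda:B\to A$ be its lower adjoint: $\varphi_\Lambda(b)\le a$ iff $b\le\varphi(a)$. Let $\mathbf{OAL}$ be the category whose objects are all complete local contact algebras and whose morphisms $\varphi:(A,\rho,\mathbb B)\to(B,\eta,\mathbb B')$ are all complete Boolean homomorphisms $A\to B$ such that (L1) for all $a,b\in A$, $\varphi(a)\,\eta\,\varphi(b)$ implies $a\rho b$; (L2) $b\in\mathbb B'$ implies $\varphi_\Lambda(b)\in\mathbb B$; (LO) for all $a\in A$ and $b\in\mathbb B'$, $\varphi_\Lambda(b)\,\rho\, a$ implies $b\,\eta\,\varphi(a)$. Let $\mathbf{IOA}$ be the category whose objects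 are all complete MVD-algebras and whose morphisms $\varphi:(B,\le,\ll)\to(B',\le',\ll')$ are all complete Boolean homomorphisms $B\to B'$ such that (S1) for all $a,b\in B$, if $c\wedge a\ll c^*\vee b$ for every $c\in B$ with $c\ll 1$, then $d\wedge\varphi(a)\ll' d^*\vee\varphi(b)$ for every $d\in B'$ with $d\ll' 1$; (S2) for all $b\in B'$, $b\ll'1$ implies $\varphi_\Lambda(b)\ll 1$; (SO) for all $a\in B$ and $b\in B'$, $b\ll'\varphi(a)$ implies $\varphi_\Lambda(b)\ll a$. In both categories composition is composition of functions. \textbf{Theorem.} The categories $\mathbf{OAL}$ and $\mathbf{IOA}$ are isomorphic. Moreover, the category $\mathbf{OLC}$ of all locally compact Hausdorff spaces (the empty space included) and all continuous open maps between them is dually equivalent to $\mathbf{IOA}$. -/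

import Mathlib

open CategoryTheory

universe u

section Algebras

variable {B : Type u} [BooleanAlgebra B]

/-- `C` is a contact relation on the Boolean algebra `B` (axioms (C1)-(C4)). -/
structure IsContactRelation (C : B → B → Prop) : Prop where
  refl_of_ne_bot : ∀ a, a ≠ ⊥ → C a a
  ne_bot : ∀ a b, C a b → a ≠ ⊥ ∧ b ≠ ⊥
  symm : ∀ a b, C a b → C b a
  sup_iff : ∀ a b c, C a (b ⊔ c) ↔ C a b ∨ C a c

/-- Non-tangential inclusion `a ≪_C b`: `a` is not in contact with the complement of `b`. -/
def NonTangential (C : B → B → Prop) (a b : B) : Prop := ¬ C a bᶜ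

/-- `(B, ρ, 𝔹)` is a local contact algebra: `ρ` is a contact relation and the set `𝔹` of
bounded elements satisfies (BB1)-(BB3), (BC1)-(BC3). -/
structure IsLocalContactAlgebra (ρ : B → B → Prop) (𝔹 : Set B) : Prop where
  contact : IsContactRelation ρ
  bot_mem : ⊥ ∈ 𝔹
  mem_of_le : ∀ a b, a ≤ b → b ∈ 𝔹 → a ∈ 𝔹
  sup_mem : ∀ a b, a ∈ 𝔹 → b ∈ 𝔹 → a ⊔ b ∈ 𝔹
  interpolate : ∀ a c, a ∈ 𝔹 → NonTangential ρ a c →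
    ∃ b ∈ 𝔹, NonTangential ρ a b ∧ NonTangential ρ b c
  exists_bounded : ∀ a b, ρ a b → ∃ c ∈ 𝔹, ρ a (c ⊓ b)
  exists_inside : ∀ a, a ≠ ⊥ → ∃ b ∈ 𝔹, b ≠ ⊥ ∧ NonTangential ρ b a

/-- `(B, ≤, ≪)` is an MVD-algebra: axioms (≪1)-(≪6), (≪4*) and (MVD). -/
structure IsMVDAlgebra (ll : B → B → Prop) : Prop where
  le_of_ll : ∀ a b, ll a b → a ≤ b
  bot_ll_bot : ll ⊥ ⊥
  mono : ∀ a b c t, a ≤ b → ll b c → c ≤ t → ll a t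
  sup_ll : ∀ a b c, ll a c → ll b c → ll (a ⊔ b) c
  interpolate : ∀ a c, ll a c → ∃ b, ll a b ∧ ll b c
  exists_inside : ∀ a, a ≠ ⊥ → ∃ b, b ≠ ⊥ ∧ ll b a
  ll_inf : ∀ a b c, ll a b → ll a c → ll a (b ⊓ c)
  mvd : ∀ a b, ll a ⊤ → ll bᶜ aᶜ → ll a b

end Algebras

section LowerAdjoint

variable {A B D : Type u} [CompleteBooleanAlgebra A] [CompleteBooleanAlgebra B]
  [CompleteBooleanAlgebra D]

/-- The lower adjoint `φ_Λ : B → A` of a complete Boolean homomorphism `φ : A → B`.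
(A map of complete Boolean algebras that preserves all joins and all meets preserves
`⊥`, `⊤` and complements, so `CompleteLatticeHom A B` is the type of complete Boolean
homomorphisms.) -/
def lowerAdjoint (φ : CompleteLatticeHom A B) (b : B) : A := sInf {a | b ≤ φ a}

/-- `lowerAdjoint φ` has the defining property of the lower adjoint:
`φ_Λ b ≤ a` iff `b ≤ φ a`. -/
theorem lowerAdjoint_gc (φ : CompleteLatticeHom A B) :
    GaloisConnection (lowerAdjoint φ) φ := by
  intro b a
  constructor
  · intro h
    have h1 : b ≤ φ (lowerAdjoint φ b) := by
      unfold lowerAdjoint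
      rw [map_sInf]
      apply le_sInf
      rintro _ ⟨x, hx, rfl⟩
      exact hx
    exact h1.trans (OrderHomClass.mono φ h)
  · intro h
    exact sInf_le h

theorem lowerAdjoint_id (b : B) : lowerAdjoint (CompleteLatticeHom.id B) b = b := by
  apply le_antisymm
  · exact (lowerAdjoint_gc (CompleteLatticeHom.id B) b b).2 le_rfl
  · exact (lowerAdjoint_gc (CompleteLatticeHom.id B) b _).1 le_rfl

theorem lowerAdjoint_comp (ψ : CompleteLatticeHom B D) (φ : CompleteLatticeHom A B) (d : D) :
    lowerAdjoint (ψ.comp φ) d = lowerAdjoint φ (lowerAdjoint ψ d) := by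
  apply eq_of_forall_ge_iff
  intro a
  rw [lowerAdjoint_gc (ψ.comp φ) d a, lowerAdjoint_gc φ _ a, lowerAdjoint_gc ψ d _]
  rfl

end LowerAdjoint

section Morphisms

variable {A B : Type u} [CompleteBooleanAlgebra A] [CompleteBooleanAlgebra B]

/-- The conditions (L1) and (L2) on a complete Boolean homomorphism
`φ : (A, ρ, 𝔹) → (B, η, 𝔹')` of complete local contact algebras. -/
structure IsSKALMorphism (ρ : A → A → Prop) (𝔹 : Set A) (η : B → B → Prop) (𝔹' : Set B)
    (φ : CompleteLatticeHom A B) : Prop where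
  L1 : ∀ a b : A, η (φ a) (φ b) → ρ a b
  L2 : ∀ b : B, b ∈ 𝔹' → lowerAdjoint φ b ∈ 𝔹

/-- An OAL-morphism is a SKAL-morphism satisfying (LO). -/
structure IsOALMorphism (ρ : A → A → Prop) (𝔹 : Set A) (η : B → B → Prop) (𝔹' : Set B)
    (φ : CompleteLatticeHom A B) : Prop extends IsSKALMorphism ρ 𝔹 η 𝔹' φ where
  LO : ∀ (a : A) (b : B), b ∈ 𝔹' → ρ (lowerAdjoint φ b) a → η b (φ a)

/-- The conditions (S1) and (S2) on a complete Boolean homomorphism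
`φ : (A, ≤, ≪) → (B, ≤', ≪')` of complete MVD-algebras. -/
structure IsIKAMorphism (ll : A → A → Prop) (ll' : B → B → Prop)
    (φ : CompleteLatticeHom A B) : Prop where
  S1 : ∀ a b : A, (∀ c : A, ll c ⊤ → ll (c ⊓ a) (cᶜ ⊔ b)) →
    ∀ d : B, ll' d ⊤ → ll' (d ⊓ φ a) (dᶜ ⊔ φ b)
  S2 : ∀ b : B, ll' b ⊤ → ll (lowerAdjoint φ b) ⊤

/-- An IOA-morphism is an IKA-morphism satisfying (SO). -/
structure IsIOAMorphism (ll : A → A → Prop) (ll' : B → B → Prop)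
    (φ : CompleteLatticeHom A B) : Prop extends IsIKAMorphism ll ll' φ where
  SO : ∀ (a : A) (b : B), ll' b (φ a) → ll (lowerAdjoint φ b) a

end Morphisms

section CategoryOAL

/-- The objects of OAL: complete local contact algebras. -/
structure OAL : Type (u + 1) where
  carrier : Type u
  [algebra : CompleteBooleanAlgebra carrier]
  rel : carrier → carrier → Prop
  bounded : Set carrier
  isLCA : IsLocalContactAlgebra rel bounded

attribute [instance] OAL.algebra

/-- The morphisms of OAL. -/
@[ext]
structure OAL.Hom (X Y : OAL.{u}) : Type u where
  toMap : CompleteLatticeHom X.carrier Y.carrier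
  isOAL : IsOALMorphism X.rel X.bounded Y.rel Y.bounded toMap

/-- The category OAL; composition is composition of functions. -/
instance OAL.category : Category.{u} OAL.{u} where
  Hom X Y := OAL.Hom X Y
  id X :=
    { toMap := CompleteLatticeHom.id X.carrier
      isOAL :=
        { L1 := fun _ _ h => h
          L2 := fun b hb => by rw [lowerAdjoint_id]; exact hb
          LO := fun a b _ h => by rw [lowerAdjoint_id] at h; exact h } }
  comp f g :=
    { toMap := g.toMap.comp f.toMap
      isOAL :=
        { L1 := fun a b h => f.isOAL.L1 a b (g.isOAL.L1 _ _ h)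
          L2 := fun b hb => by
            rw [lowerAdjoint_comp]
            exact f.isOAL.L2 _ (g.isOAL.L2 b hb)
          LO := fun a b hb h => by
            rw [lowerAdjoint_comp] at h
            exact g.isOAL.LO _ b hb (f.isOAL.LO a _ (g.isOAL.L2 b hb) h) } }
  id_comp _ := rfl
  comp_id _ := rfl
  assoc _ _ _ := rfl

end CategoryOAL

section CategoryIOA

/-- The objects of IOA: complete MVD-algebras. -/
structure IOA : Type (u + 1) where
  carrier : Type u
  [algebra : CompleteBooleanAlgebra carrier]
  ll : carrier → carrier → Prop
  isMVD : IsMVDAlgebra ll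

attribute [instance] IOA.algebra

/-- The morphisms of IOA. -/
@[ext]
structure IOA.Hom (X Y : IOA.{u}) : Type u where
  toMap : CompleteLatticeHom X.carrier Y.carrier
  isIOA : IsIOAMorphism X.ll Y.ll toMap

/-- The category IOA; composition is composition of functions. -/
instance IOA.category : Category.{u} IOA.{u} where
  Hom X Y := IOA.Hom X Y
  id X :=
    { toMap := CompleteLatticeHom.id X.carrier
      isIOA :=
        { S1 := fun _ _ h => h
          S2 := fun b hb => by rw [lowerAdjoint_id]; exact hb
          SO := fun a b h => by rw [lowerAdjoint_id]; exact h } }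
  comp f g :=
    { toMap := g.toMap.comp f.toMap
      isIOA :=
        { S1 := fun a b h => g.isIOA.S1 _ _ (f.isIOA.S1 a b h)
          S2 := fun b hb => by
            rw [lowerAdjoint_comp]
            exact f.isIOA.S2 _ (g.isIOA.S2 b hb)
          SO := fun a b h => by
            rw [lowerAdjoint_comp]
            exact f.isIOA.SO a _ (g.isIOA.SO _ b h) } }
  id_comp _ := rfl
  comp_id _ := rfl
  assoc _ _ _ := rfl

end CategoryIOA

section CategoryOLC

/-- The objects of OLC: locally compact Hausdorff spaces (possibly empty). -/
structure OLC : Type (u + 1) where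
  carrier : Type u
  [top : TopologicalSpace carrier]
  [t2 : T2Space carrier]
  [locallyCompact : LocallyCompactSpace carrier]

attribute [instance] OLC.top OLC.t2 OLC.locallyCompact

/-- The morphisms of OLC: continuous open maps. -/
@[ext]
structure OLC.Hom (X Y : OLC.{u}) : Type u where
  toMap : ContinuousOpenMap X.carrier Y.carrier

/-- The category OLC of locally compact Hausdorff spaces and (continuous) open maps. -/
instance OLC.category : Category.{u} OLC.{u} where
  Hom X Y := OLC.Hom X Y
  id X := ⟨ContinuousOpenMap.id X.carrier⟩
  comp f g := ⟨g.toMap.comp f.toMap⟩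
  id_comp _ := rfl
  comp_id _ := rfl
  assoc _ _ _ := rfl

end CategoryOLC

/-! ### Local contact algebras and MVD-algebras on a fixed Boolean algebra. -/

section AlgebraCorrespondence

variable {B : Type u} [BooleanAlgebra B]

/-! For the isomorphism, the Boolean algebra and the underlying map of each morphism stay fixed. A
local contact algebra gives `a ≪ b` iff `a` is bounded and `a ≪_ρ b`; conversely the bounded
elements are those with `a ≪ 1`, and `ρ` is recovered by testing on bounded pieces. These passages
are strictly inverse (`contactOf_strongInclusion`, `strongInclusion_contactOf`) and exchange the two
kinds of morphism.

For the duality, a space goes to its regular open sets, with `U ≪ V` iff the closure of `U` is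
compact and lies in `V`, and a continuous open map goes to its preimage homomorphism. Essential
surjectivity is a Stone-type representation: the points of an MVD-algebra are its round filters
satisfying a primeness condition, they form a locally compact Hausdorff space, and `ll_iff` together
with `exists_basicRegularOpen_eq` recovers the algebra. Fullness reads off a map from `x ↦ {V | x ∈
φ V}`, which is such a filter (`exists_continuousOpenMap`); faithfulness holds because regular open
sets separate points. -/

theorem IsContactRelation.mono {C : B → B → Prop} (h : IsContactRelation C) {a b c d : B}
    (hac : a ≤ c) (hbd : b ≤ d) (hab : C a b) : C c d := by
  have h1 : C a d := by
    rw [← sup_eq_right.2 hbd, h.sup_iff]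
    exact Or.inl hab
  apply h.symm
  rw [← sup_eq_right.2 hac, h.sup_iff]
  exact Or.inl (h.symm _ _ h1)

theorem IsContactRelation.le_of_nonTangential {C : B → B → Prop} (h : IsContactRelation C)
    {a b : B} (hab : NonTangential C a b) : a ≤ b := by
  by_contra hle
  have hne : a ⊓ bᶜ ≠ ⊥ := fun h0 => hle (by
    rw [← compl_compl b]; exact (disjoint_iff.2 h0).le_compl_right)
  exact hab (h.mono inf_le_left inf_le_right (h.refl_of_ne_bot _ hne))

/-- The strong inclusion `a ≪ b` of a local contact algebra: `a` is bounded and `a ≪_ρ b`. -/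
def strongInclusion (ρ : B → B → Prop) (𝔹 : Set B) (a b : B) : Prop :=
  a ∈ 𝔹 ∧ NonTangential ρ a b

/-- The contact relation of an MVD-algebra: `a ≪_ρ b` means that `c ⊓ a ≪ cᶜ ⊔ b` for all
bounded `c`. -/
def contactOf (ll : B → B → Prop) (a b : B) : Prop :=
  ∃ c, ll c ⊤ ∧ ¬ ll (c ⊓ a) (cᶜ ⊔ bᶜ)

namespace IsLocalContactAlgebra

variable {ρ : B → B → Prop} {𝔹 : Set B}

theorem strongInclusion_top (h : IsLocalContactAlgebra ρ 𝔹) (a : B) :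
    strongInclusion ρ 𝔹 a ⊤ ↔ a ∈ 𝔹 := by
  refine ⟨And.left, fun ha => ⟨ha, fun hr => ?_⟩⟩
  exact (h.contact.ne_bot _ _ hr).2 compl_top

theorem isMVDAlgebra (h : IsLocalContactAlgebra ρ 𝔹) : IsMVDAlgebra (strongInclusion ρ 𝔹) where
  le_of_ll a b hab := h.contact.le_of_nonTangential hab.2
  bot_ll_bot := ⟨h.bot_mem, fun hr => (h.contact.ne_bot _ _ hr).1 rfl⟩
  mono a b c t hab hbc hct := ⟨h.mem_of_le _ _ hab hbc.1, fun hr =>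
    hbc.2 (h.contact.mono hab (compl_le_compl hct) hr)⟩
  sup_ll a b c hac hbc := ⟨h.sup_mem _ _ hac.1 hbc.1, fun hr => by
    rcases (h.contact.sup_iff _ _ _).1 (h.contact.symm _ _ hr) with h1 | h1
    · exact hac.2 (h.contact.symm _ _ h1)
    · exact hbc.2 (h.contact.symm _ _ h1)⟩
  interpolate a c hac := by
    obtain ⟨b, hb, hab, hbc⟩ := h.interpolate a c hac.1 hac.2
    exact ⟨b, ⟨hac.1, hab⟩, ⟨hb, hbc⟩⟩
  exists_inside a ha := by
    obtain ⟨b, hb, hb0, hba⟩ := h.exists_inside a ha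
    exact ⟨b, hb0, hb, hba⟩
  ll_inf a b c hab hac := ⟨hab.1, fun hr => by
    rw [compl_inf, h.contact.sup_iff] at hr
    exact hr.elim hab.2 hac.2⟩
  mvd a b ha hba := ⟨ha.1, fun hr => hba.2 (by
    rw [compl_compl]
    exact h.contact.symm _ _ hr)⟩

theorem contactOf_strongInclusion (h : IsLocalContactAlgebra ρ 𝔹) :
    contactOf (strongInclusion ρ 𝔹) = ρ := by
  funext a b
  apply propext
  constructor
  · rintro ⟨c, hc, hn⟩
    by_contra hab
    refine hn ⟨h.mem_of_le _ _ inf_le_left hc.1, fun hr => hab ?_⟩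
    rw [compl_sup, compl_compl, compl_compl] at hr
    exact h.contact.mono inf_le_right inf_le_right hr
  · intro hab
    -- Each argument of `ρ` is cut down to a bounded piece, using symmetry for the second cut; the
    -- join of the two bounds serves both.
    obtain ⟨c, hc, h1⟩ := h.exists_bounded a b hab
    obtain ⟨d, hd, h2⟩ := h.exists_bounded _ _ (h.contact.symm _ _ h1)
    refine ⟨c ⊔ d, (h.strongInclusion_top _).2 (h.sup_mem _ _ hc hd), fun hn => hn.2 ?_⟩
    rw [compl_sup, compl_compl, compl_compl]
    exact h.contact.mono (inf_le_inf_right _ le_sup_right) (inf_le_inf_right _ le_sup_left)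
      (h.contact.symm _ _ h2)

theorem setOf_strongInclusion_top (h : IsLocalContactAlgebra ρ 𝔹) :
    {a | strongInclusion ρ 𝔹 a ⊤} = 𝔹 :=
  Set.ext h.strongInclusion_top

end IsLocalContactAlgebra

namespace IsMVDAlgebra

variable {ll : B → B → Prop}

theorem bounded_of_ll (h : IsMVDAlgebra ll) {a b : B} (hab : ll a b) : ll a ⊤ :=
  h.mono _ _ _ _ le_rfl hab le_top

theorem bot_ll (h : IsMVDAlgebra ll) (a : B) : ll ⊥ a :=
  h.mono _ _ _ _ le_rfl h.bot_ll_bot bot_le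

theorem inf_ll_inf (h : IsMVDAlgebra ll) {a b c d : B} (hac : ll a c) (hbd : ll b d) :
    ll (a ⊓ b) (c ⊓ d) :=
  h.ll_inf _ _ _ (h.mono _ _ _ _ inf_le_left hac le_rfl) (h.mono _ _ _ _ inf_le_right hbd le_rfl)

/-- Plain contraposition fails because `bᶜ` may be unbounded; meeting with a bounded `d` makes the
axiom `mvd` applicable. -/
theorem inf_compl_ll_compl (h : IsMVDAlgebra ll) {a b d : B} (hab : ll a b) (hd : ll d ⊤) :
    ll (d ⊓ bᶜ) aᶜ := by
  apply h.mvd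
  · exact h.mono _ _ _ _ inf_le_left hd le_rfl
  · rw [compl_compl, compl_inf, compl_compl]
    exact h.mono _ _ _ _ le_rfl hab le_sup_right

theorem not_contactOf (a b : B) :
    ¬ contactOf ll a b ↔ ∀ c, ll c ⊤ → ll (c ⊓ a) (cᶜ ⊔ bᶜ) := by
  simp [contactOf]

theorem nonTangential_contactOf (a b : B) :
    NonTangential (contactOf ll) a b ↔ ∀ c, ll c ⊤ → ll (c ⊓ a) (cᶜ ⊔ b) := by
  simp [NonTangential, contactOf]

/-- A bounded `a` needs a single test: for `a ≪ e ≪ 1`, testing at `e` gives `a ≪ eᶜ ⊔ b`, and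
meeting with `a ≪ e` leaves `a ≪ e ⊓ b`. -/
theorem nonTangential_contactOf_iff_ll (h : IsMVDAlgebra ll) {a b : B} (ha : ll a ⊤) :
    NonTangential (contactOf ll) a b ↔ ll a b := by
  rw [nonTangential_contactOf]
  constructor
  · intro hab
    obtain ⟨e, hae, he⟩ := h.interpolate _ _ ha
    have h1 := hab e he
    rw [inf_eq_right.2 (h.le_of_ll _ _ hae)] at h1
    refine h.mono _ _ _ _ le_rfl (h.ll_inf _ _ _ hae h1) ?_
    rw [inf_sup_left, inf_compl_eq_bot, bot_sup_eq]
    exact inf_le_right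
  · intro hab c _
    exact h.mono _ _ _ _ inf_le_right hab le_sup_right

theorem isContactRelation (h : IsMVDAlgebra ll) : IsContactRelation (contactOf ll) where
  refl_of_ne_bot a ha := by
    obtain ⟨b, hb, hba⟩ := h.exists_inside a ha
    -- The test at `b` would put `b ⊓ a = b` below its own complement.
    refine ⟨b, h.bounded_of_ll hba, fun hn => hb ?_⟩
    have hle := h.le_of_ll _ _ hn
    rw [← compl_inf] at hle
    have h0 := le_compl_self.1 hle
    rwa [inf_eq_left.2 (h.le_of_ll _ _ hba)] at h0
  ne_bot a b := by
    rintro ⟨c, hc, hn⟩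
    constructor
    · rintro rfl
      exact hn (by rw [inf_bot_eq]; exact h.bot_ll _)
    · rintro rfl
      exact hn (by rw [compl_bot, sup_top_eq]; exact h.mono _ _ _ _ inf_le_left hc le_rfl)
  symm a b := by
    rintro ⟨c, hc, hn⟩
    refine ⟨c, hc, fun hm => hn ?_⟩
    apply h.mvd
    · exact h.mono _ _ _ _ inf_le_left hc le_rfl
    · rwa [compl_sup, compl_compl, compl_compl, compl_inf]
  sup_iff a b c := by
    rw [← not_iff_not, not_or, not_contactOf, not_contactOf, not_contactOf]
    constructor
    · intro hd
      exact ⟨fun d hdt => h.mono _ _ _ _ le_rfl (hd d hdt)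
          (sup_le_sup_left (compl_le_compl le_sup_left) _),
        fun d hdt => h.mono _ _ _ _ le_rfl (hd d hdt)
          (sup_le_sup_left (compl_le_compl le_sup_right) _)⟩
    · rintro ⟨h1, h2⟩ d hd
      rw [compl_sup, sup_inf_left]
      exact h.ll_inf _ _ _ (h1 d hd) (h2 d hd)

theorem isLocalContactAlgebra (h : IsMVDAlgebra ll) :
    IsLocalContactAlgebra (contactOf ll) {a | ll a ⊤} where
  contact := h.isContactRelation
  bot_mem := h.bot_ll ⊤
  mem_of_le a b hab hb := h.mono _ _ _ _ hab hb le_rfl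
  sup_mem a b := h.sup_ll a b ⊤
  interpolate a c ha hac := by
    obtain ⟨b, hab, hbc⟩ := h.interpolate _ _ ((h.nonTangential_contactOf_iff_ll ha).1 hac)
    exact ⟨b, h.bounded_of_ll hbc, (h.nonTangential_contactOf_iff_ll ha).2 hab,
      (h.nonTangential_contactOf_iff_ll (h.bounded_of_ll hbc)).2 hbc⟩
  exists_bounded a b := by
    rintro ⟨c, hc, hn⟩
    refine ⟨c, hc, c, hc, fun hm => hn ?_⟩
    rwa [compl_inf, ← sup_assoc, sup_idem] at hm
  exists_inside a ha := by
    obtain ⟨b, hb, hba⟩ := h.exists_inside a ha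
    exact ⟨b, h.bounded_of_ll hba, hb,
      (h.nonTangential_contactOf_iff_ll (h.bounded_of_ll hba)).2 hba⟩

theorem strongInclusion_contactOf (h : IsMVDAlgebra ll) :
    strongInclusion (contactOf ll) {a | ll a ⊤} = ll := by
  funext a b
  apply propext
  constructor
  · rintro ⟨ha, hab⟩
    exact (h.nonTangential_contactOf_iff_ll ha).1 hab
  · intro hab
    have ha := h.bounded_of_ll hab
    exact ⟨ha, (h.nonTangential_contactOf_iff_ll ha).2 hab⟩

end IsMVDAlgebra

end AlgebraCorrespondence

/-! ### Translation of the morphism conditions. -/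

section MorphismCorrespondence

variable {A B : Type u} [CompleteBooleanAlgebra A] [CompleteBooleanAlgebra B]

theorem CompleteLatticeHom.map_compl_eq (φ : CompleteLatticeHom A B) (a : A) :
    φ aᶜ = (φ a)ᶜ := by
  have h : IsCompl a aᶜ := isCompl_compl
  have h1 : φ a ⊓ φ aᶜ = ⊥ := by rw [← map_inf, h.inf_eq_bot, map_bot]
  have h2 : φ a ⊔ φ aᶜ = ⊤ := by rw [← map_sup, h.sup_eq_top, map_top]
  exact (IsCompl.of_eq h1 h2).compl_eq.symm

theorem IsOALMorphism.isIOAMorphism {ρ : A → A → Prop} {𝔹 : Set A} {η : B → B → Prop}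
    {𝔹' : Set B} (hA : IsLocalContactAlgebra ρ 𝔹) (hB : IsLocalContactAlgebra η 𝔹')
    {φ : CompleteLatticeHom A B} (hφ : IsOALMorphism ρ 𝔹 η 𝔹' φ) :
    IsIOAMorphism (strongInclusion ρ 𝔹) (strongInclusion η 𝔹') φ where
  S1 a b hab := by
    rw [← IsMVDAlgebra.nonTangential_contactOf, hA.contactOf_strongInclusion] at hab
    rw [← IsMVDAlgebra.nonTangential_contactOf, hB.contactOf_strongInclusion]
    intro hr
    rw [← φ.map_compl_eq] at hr
    exact hab (hφ.L1 _ _ hr)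
  S2 b hb := by
    rw [hA.strongInclusion_top]
    exact hφ.L2 b hb.1
  SO a b hb := ⟨hφ.L2 b hb.1, fun hr => hb.2 (by
    rw [← φ.map_compl_eq]
    exact hφ.LO _ _ hb.1 hr)⟩

theorem IsIOAMorphism.isOALMorphism {ll : A → A → Prop} {ll' : B → B → Prop}
    (hA : IsMVDAlgebra ll) (hB : IsMVDAlgebra ll')
    {φ : CompleteLatticeHom A B} (hφ : IsIOAMorphism ll ll' φ) :
    IsOALMorphism (contactOf ll) {a | ll a ⊤} (contactOf ll') {b | ll' b ⊤} φ where
  L1 a b hab := by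
    by_contra hn
    rw [← compl_compl b] at hn
    have h1 := hφ.S1 _ _ ((IsMVDAlgebra.nonTangential_contactOf _ _).1 hn)
    rw [← IsMVDAlgebra.nonTangential_contactOf, φ.map_compl_eq] at h1
    apply h1
    rwa [compl_compl]
  L2 := hφ.S2
  LO a b hb hr := by
    by_contra hn
    rw [← compl_compl (φ a), ← φ.map_compl_eq] at hn
    have h1 := hφ.SO _ _ ((hB.nonTangential_contactOf_iff_ll hb).1 hn)
    rw [← hA.nonTangential_contactOf_iff_ll (hφ.S2 b hb)] at h1
    apply h1
    rwa [compl_compl]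

end MorphismCorrespondence

/-! ### The isomorphism of OAL and IOA. -/

section CategoryIsomorphism

/-- The functor sending a complete local contact algebra to its MVD-algebra. -/
def oalToIoa : OAL.{u} ⥤ IOA.{u} where
  obj X := ⟨X.carrier, strongInclusion X.rel X.bounded, X.isLCA.isMVDAlgebra⟩
  map {X Y} f := ⟨f.toMap, f.isOAL.isIOAMorphism X.isLCA Y.isLCA⟩
  map_id _ := rfl
  map_comp _ _ := rfl

/-- The functor sending a complete MVD-algebra to its local contact algebra. -/
def ioaToOal : IOA.{u} ⥤ OAL.{u} where
  obj X := ⟨X.carrier, contactOf X.ll, {a | X.ll a ⊤}, X.isMVD.isLocalContactAlgebra⟩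
  map {X Y} f := ⟨f.toMap, f.isIOA.isOALMorphism X.isMVD Y.isMVD⟩
  map_id _ := rfl
  map_comp _ _ := rfl

/-- Equality of functors compares morphisms whose objects agree only propositionally. With the
relations and bounded sets as free variables, `subst` identifies the objects. -/
theorem OAL.hom_heq {A B : Type u} [CompleteBooleanAlgebra A] [CompleteBooleanAlgebra B]
    {ρ ρ' : A → A → Prop} {𝔹 𝔹' : Set A} {η η' : B → B → Prop} {𝔻 𝔻' : Set B}
    {h : IsLocalContactAlgebra ρ 𝔹} {h' : IsLocalContactAlgebra ρ' 𝔹'}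
    {k : IsLocalContactAlgebra η 𝔻} {k' : IsLocalContactAlgebra η' 𝔻'}
    (hρ : ρ = ρ') (h𝔹 : 𝔹 = 𝔹') (hη : η = η') (h𝔻 : 𝔻 = 𝔻')
    (f : OAL.Hom ⟨A, ρ, 𝔹, h⟩ ⟨B, η, 𝔻, k⟩) (f' : OAL.Hom ⟨A, ρ', 𝔹', h'⟩ ⟨B, η', 𝔻', k'⟩)
    (hf : f.toMap = f'.toMap) : HEq f f' := by
  subst hρ h𝔹 hη h𝔻
  exact heq_of_eq (OAL.Hom.ext hf)

theorem IOA.hom_heq {A B : Type u} [CompleteBooleanAlgebra A] [CompleteBooleanAlgebra B]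
    {ll ll' : A → A → Prop} {kk kk' : B → B → Prop}
    {h : IsMVDAlgebra ll} {h' : IsMVDAlgebra ll'} {k : IsMVDAlgebra kk} {k' : IsMVDAlgebra kk'}
    (hl : ll = ll') (hk : kk = kk')
    (f : IOA.Hom ⟨A, ll, h⟩ ⟨B, kk, k⟩) (f' : IOA.Hom ⟨A, ll', h'⟩ ⟨B, kk', k'⟩)
    (hf : f.toMap = f'.toMap) : HEq f f' := by
  subst hl hk
  exact heq_of_eq (IOA.Hom.ext hf)

theorem oalToIoa_comp_ioaToOal : oalToIoa.{u} ⋙ ioaToOal = 𝟭 OAL.{u} := by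
  refine CategoryTheory.Functor.hext ?_ ?_
  · rintro ⟨B, ρ, 𝔹, h⟩
    simp only [Functor.comp_obj, oalToIoa, ioaToOal, Functor.id_obj,
      h.contactOf_strongInclusion, h.setOf_strongInclusion_top]
  · rintro ⟨A, ρ, 𝔹, h⟩ ⟨B, η, 𝔻, k⟩ f
    exact OAL.hom_heq h.contactOf_strongInclusion h.setOf_strongInclusion_top
      k.contactOf_strongInclusion k.setOf_strongInclusion_top _ _ rfl

theorem ioaToOal_comp_oalToIoa : ioaToOal.{u} ⋙ oalToIoa = 𝟭 IOA.{u} := by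
  refine CategoryTheory.Functor.hext ?_ ?_
  · rintro ⟨B, ll, h⟩
    simp only [Functor.comp_obj, oalToIoa, ioaToOal, Functor.id_obj,
      h.strongInclusion_contactOf]
  · rintro ⟨A, ll, h⟩ ⟨B, kk, k⟩ f
    exact IOA.hom_heq h.strongInclusion_contactOf k.strongInclusion_contactOf _ _ rfl

/-- The isomorphism of the categories OAL and IOA. -/
def oalIsoIoa : Cat.of OAL.{u} ≅ Cat.of IOA.{u} where
  hom := oalToIoa.toCatHom
  inv := ioaToOal.toCatHom
  hom_inv_id := by
    apply Cat.Hom.ext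
    exact oalToIoa_comp_ioaToOal
  inv_hom_id := by
    apply Cat.Hom.ext
    exact ioaToOal_comp_oalToIoa

end CategoryIsomorphism

/-! ### The MVD-algebra of regular open sets and its functoriality. -/

section RegularOpens

open TopologicalSpace ContinuousOpenMapClass

/-- The regular open subsets of a topological space. -/
def RegularOpens (X : Type u) [TopologicalSpace X] : Type u := Heyting.Regular (Opens X)

namespace RegularOpens

variable {X Y : Type u} [TopologicalSpace X] [TopologicalSpace Y]

instance : CompleteBooleanAlgebra (RegularOpens X) where
  __ := (inferInstance : BooleanAlgebra (Heyting.Regular (Opens X)))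
  __ := (Heyting.Regular.gi (α := Opens X)).liftCompleteLattice

/-- The open set underlying a regular open set. -/
def toOpens (U : RegularOpens X) : Opens X := Heyting.Regular.val U

instance : SetLike (RegularOpens X) X where
  coe U := (U.toOpens : Set X)
  coe_injective _ _ h := Heyting.Regular.coe_injective (SetLike.coe_injective h)

theorem le_iff_subset {U V : RegularOpens X} : U ≤ V ↔ (U : Set X) ⊆ V := Iff.rfl

theorem isOpen (U : RegularOpens X) : IsOpen (U : Set X) := U.toOpens.isOpen

theorem coe_compl (U : RegularOpens X) :
    ((Uᶜ : RegularOpens X) : Set X) = (closure (U : Set X))ᶜ := by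
  have h := Opens.coe_compl_eq_interior_compl (U := U.toOpens)
  rw [interior_compl] at h
  exact h

theorem coe_bot : ((⊥ : RegularOpens X) : Set X) = ∅ := rfl

theorem mem_top (x : X) : x ∈ (⊤ : RegularOpens X) := trivial

theorem notMem_bot (x : X) : x ∉ (⊥ : RegularOpens X) := fun h => h

theorem mem_compl {U : RegularOpens X} {x : X} : x ∈ Uᶜ ↔ x ∉ closure (U : Set X) := by
  rw [← SetLike.mem_coe, coe_compl]; rfl

theorem interior_closure (U : RegularOpens X) : interior (closure (U : Set X)) = U := by
  have h := congrArg (fun V : RegularOpens X => (V : Set X)) (compl_compl U)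
  simp only [coe_compl] at h
  rwa [closure_compl, compl_compl] at h

theorem isRegular_iff (U : Opens X) :
    Heyting.IsRegular U ↔ interior (closure (U : Set X)) = U := by
  rw [Heyting.IsRegular, ← SetLike.coe_set_eq, Opens.coe_compl_eq_interior_compl,
    Opens.coe_compl_eq_interior_compl, interior_compl (s := (U : Set X)), compl_compl]

/-- The interior of a closed set, as a regular open set. -/
def interiorOf (K : Set X) (hK : IsClosed K) : RegularOpens X :=
  ⟨⟨interior K, isOpen_interior⟩, by
    rw [isRegular_iff]
    apply subset_antisymm
    · exact interior_mono (closure_minimal interior_subset hK)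
    · exact interior_maximal subset_closure isOpen_interior⟩

theorem closure_interiorOf_subset (K : Set X) (hK : IsClosed K) :
    closure (interiorOf K hK : Set X) ⊆ K := closure_minimal interior_subset hK

/-- Preimage of regular open sets under a continuous open map. -/
def preimage (f : X →CO Y) (V : RegularOpens Y) : RegularOpens X :=
  ⟨⟨f ⁻¹' V, V.isOpen.preimage (map_continuous f)⟩, by
    rw [isRegular_iff]
    change interior (closure (f ⁻¹' (V : Set Y))) = f ⁻¹' (V : Set Y)
    rw [← (map_open f).preimage_closure_eq_closure_preimage (map_continuous f),
      ← (map_open f).preimage_interior_eq_interior_preimage (map_continuous f),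
      interior_closure]⟩

theorem coe_preimage (f : X →CO Y) (V : RegularOpens Y) :
    (preimage f V : Set X) = f ⁻¹' V := rfl

/-- The least regular open set containing the image of a regular open set under an open map. -/
def image (f : X →CO Y) (U : RegularOpens X) : RegularOpens Y :=
  Heyting.Regular.toRegular ⟨f '' U, (map_open f) _ U.isOpen⟩

theorem gc_image_preimage (f : X →CO Y) : GaloisConnection (image f) (preimage f) := by
  intro U V
  exact (Heyting.Regular.gi.gc _ V).trans Set.image_subset_iff

theorem preimage_compl (f : X →CO Y) (V : RegularOpens Y) :
    preimage f Vᶜ = (preimage f V)ᶜ := by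
  apply SetLike.coe_injective
  rw [coe_preimage, coe_compl, coe_compl, coe_preimage,
    ← (map_open f).preimage_closure_eq_closure_preimage (map_continuous f), Set.preimage_compl]

theorem preimage_sInf (f : X →CO Y) (S : Set (RegularOpens Y)) :
    preimage f (sInf S) = sInf (preimage f '' S) := by
  rw [(gc_image_preimage f).u_sInf, sInf_image]

/-- The adjunction only yields meets; joins follow by complementation. -/
theorem preimage_sSup (f : X →CO Y) (S : Set (RegularOpens Y)) :
    preimage f (sSup S) = sSup (preimage f '' S) := by
  rw [← compl_inj_iff, ← preimage_compl, compl_sSup', compl_sSup', preimage_sInf,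
    Set.image_image, Set.image_image]
  simp only [preimage_compl]

/-- Preimage under a continuous open map, as a complete Boolean homomorphism. -/
def preimageHom (f : X →CO Y) : CompleteLatticeHom (RegularOpens Y) (RegularOpens X) where
  toFun := preimage f
  map_sInf' := preimage_sInf f
  map_sSup' := preimage_sSup f

theorem coe_preimageHom (f : X →CO Y) (V : RegularOpens Y) :
    (preimageHom f V : Set X) = f ⁻¹' V := rfl

/-- `U ≪ V` if the closure of `U` is compact and contained in `V`. -/
def CompactlyInside (U V : RegularOpens X) : Prop :=
  IsCompact (closure (U : Set X)) ∧ closure (U : Set X) ⊆ V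

variable [T2Space X] [LocallyCompactSpace X]

theorem exists_between_compact {K U : Set X} (hK : IsCompact K) (hU : IsOpen U) (h : K ⊆ U) :
    ∃ V : RegularOpens X, K ⊆ V ∧ IsCompact (closure (V : Set X)) ∧ closure (V : Set X) ⊆ U := by
  obtain ⟨L, hL, hKL, hLU⟩ := exists_compact_between hK hU h
  have hcl := closure_interiorOf_subset L hL.isClosed
  exact ⟨interiorOf L hL.isClosed, hKL, hL.of_isClosed_subset isClosed_closure hcl,
    hcl.trans hLU⟩

theorem exists_mem_compactlyInside {x : X} {V : RegularOpens X} (hx : x ∈ V) :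
    ∃ U : RegularOpens X, x ∈ U ∧ CompactlyInside U V := by
  obtain ⟨U, hU, h⟩ := exists_between_compact (isCompact_singleton (x := x)) V.isOpen
    (Set.singleton_subset_iff.2 hx)
  exact ⟨U, Set.singleton_subset_iff.1 hU, h⟩

theorem exists_mem_subset {x : X} {U : Set X} (hU : IsOpen U) (hx : x ∈ U) :
    ∃ V : RegularOpens X, x ∈ V ∧ IsCompact (closure (V : Set X)) ∧ closure (V : Set X) ⊆ U := by
  obtain ⟨V, hV, h⟩ := exists_between_compact (isCompact_singleton (x := x)) hU
    (Set.singleton_subset_iff.2 hx)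
  exact ⟨V, Set.singleton_subset_iff.1 hV, h⟩

theorem eq_of_forall_mem {x y : X} (h : ∀ U : RegularOpens X, x ∈ U → y ∈ U) : x = y := by
  by_contra hne
  obtain ⟨V, hxV, -, hV⟩ := exists_mem_subset (isOpen_compl_singleton (x := y)) hne
  exact hV (subset_closure (h V hxV)) rfl

/-- This turns the quantified condition in (S1) into a topological one. The converse is local: near
`x ∈ closure U` take a relatively compact `C ∋ x`; then `x` lies in `C ⊓ (Cᶜ ⊔ V) = C ⊓ V`. -/
theorem closure_subset_iff (U V : RegularOpens X) :
    closure (U : Set X) ⊆ V ↔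
      ∀ C : RegularOpens X, CompactlyInside C ⊤ → CompactlyInside (C ⊓ U) (Cᶜ ⊔ V) := by
  constructor
  · intro h C hC
    have h1 : closure ((C ⊓ U : RegularOpens X) : Set X) ⊆ closure (C : Set X) :=
      closure_mono Set.inter_subset_left
    have h2 : closure ((C ⊓ U : RegularOpens X) : Set X) ⊆ closure (U : Set X) :=
      closure_mono Set.inter_subset_right
    exact ⟨hC.1.of_isClosed_subset isClosed_closure h1,
      (h2.trans h).trans (le_iff_subset.1 le_sup_right)⟩
  · intro h x hx
    obtain ⟨C, hxC, hC⟩ := exists_mem_compactlyInside (mem_top x)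
    have h1 : x ∈ closure ((C ⊓ U : RegularOpens X) : Set X) :=
      C.isOpen.inter_closure ⟨hxC, hx⟩
    have h2 : x ∈ C ⊓ (Cᶜ ⊔ V) := ⟨hxC, (h C hC).2 h1⟩
    rw [inf_sup_left, inf_compl_eq_bot, bot_sup_eq] at h2
    exact h2.2

theorem isMVDAlgebra : IsMVDAlgebra (CompactlyInside (X := X)) where
  le_of_ll _ _ h := subset_closure.trans h.2
  bot_ll_bot := by
    rw [CompactlyInside, coe_bot, closure_empty]
    exact ⟨isCompact_empty, subset_rfl⟩
  mono _ _ _ _ hab hbc hct :=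
    ⟨hbc.1.of_isClosed_subset isClosed_closure (closure_mono hab),
      (closure_mono hab).trans (hbc.2.trans hct)⟩
  sup_ll a b c hac hbc := by
    have h : closure ((a ⊔ b : RegularOpens X) : Set X) ⊆
        closure (a : Set X) ∪ closure (b : Set X) := by
      have hle : a ⊔ b ≤ interiorOf (closure (a : Set X) ∪ closure (b : Set X))
          (isClosed_closure.union isClosed_closure) :=
        sup_le (interior_maximal (subset_closure.trans Set.subset_union_left) a.isOpen)
          (interior_maximal (subset_closure.trans Set.subset_union_right) b.isOpen)
      exact (closure_mono hle).trans (closure_interiorOf_subset _ _)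
    exact ⟨(hac.1.union hbc.1).of_isClosed_subset isClosed_closure h,
      h.trans (Set.union_subset hac.2 hbc.2)⟩
  interpolate a c h := by
    obtain ⟨V, haV, hV, hVc⟩ := exists_between_compact h.1 c.isOpen h.2
    exact ⟨V, ⟨h.1, haV⟩, hV, hVc⟩
  exists_inside a ha := by
    have hne : (a : Set X).Nonempty := by
      rw [Set.nonempty_iff_ne_empty]
      exact fun h => ha (SetLike.coe_injective h)
    obtain ⟨x, hx⟩ := hne
    obtain ⟨U, hxU, hU⟩ := exists_mem_compactlyInside hx
    exact ⟨U, fun h => notMem_bot x (h ▸ hxU), hU⟩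
  ll_inf _ _ _ hab hac := ⟨hab.1, Set.subset_inter hab.2 hac.2⟩
  mvd a b ha hba := by
    refine ⟨ha.1, fun x hx => ?_⟩
    by_contra hxb
    have h1 : x ∈ closure ((bᶜ : RegularOpens X) : Set X) := by
      rw [coe_compl, closure_compl, interior_closure]
      exact hxb
    exact mem_compl.1 (hba.2 h1) hx

/-- The compact image of `closure U` lies in `V`, so a relatively compact `W` fits in between, and
adjointness puts the lower adjoint of `U` below `W`. This yields (SO), and (S2) at `V = ⊤`. -/
theorem lowerAdjoint_preimageHom_compactlyInside (f : Y →CO X) {U : RegularOpens Y}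
    {V : RegularOpens X} (h : CompactlyInside U (preimageHom f V)) :
    CompactlyInside (lowerAdjoint (preimageHom f) U) V := by
  obtain ⟨W, hUW, hW, hWV⟩ := exists_between_compact (h.1.image (map_continuous f)) V.isOpen
    (Set.image_subset_iff.2 h.2)
  have h1 : U ≤ preimageHom f W := fun x hx =>
    hUW (Set.mem_image_of_mem f (subset_closure hx))
  have h2 := closure_mono (le_iff_subset.1 ((lowerAdjoint_gc (preimageHom f) U W).2 h1))
  exact ⟨hW.of_isClosed_subset isClosed_closure h2, h2.trans hWV⟩

theorem isIOAMorphism_preimageHom [T2Space Y] [LocallyCompactSpace Y] (f : X →CO Y) :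
    IsIOAMorphism (CompactlyInside (X := Y)) (CompactlyInside (X := X)) (preimageHom f) where
  S1 U V h := by
    rw [← closure_subset_iff] at h ⊢
    rw [coe_preimageHom, coe_preimageHom]
    exact ((map_continuous f).closure_preimage_subset _).trans (Set.preimage_mono h)
  S2 U h := lowerAdjoint_preimageHom_compactlyInside f (by rwa [map_top])
  SO V U h := lowerAdjoint_preimageHom_compactlyInside f h

end RegularOpens

/-- The contravariant functor sending a locally compact Hausdorff space to the MVD-algebra of
its regular open sets. -/
def olcToIoa : OLC.{u}ᵒᵖ ⥤ IOA.{u} where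
  obj X := ⟨RegularOpens X.unop.carrier, RegularOpens.CompactlyInside, RegularOpens.isMVDAlgebra⟩
  map f := ⟨RegularOpens.preimageHom f.unop.toMap, RegularOpens.isIOAMorphism_preimageHom _⟩
  map_id _ := rfl
  map_comp _ _ := rfl

end RegularOpens

/-! ### The space of points of an MVD-algebra. -/

section Points

variable {B : Type u} [BooleanAlgebra B]

/-- A point of an MVD-algebra: a proper round filter `p` such that `a ≪ b` implies `aᶜ ∈ p` or
`b ∈ p`. -/
structure IsMVDPoint (ll : B → B → Prop) (p : Set B) : Prop where
  top_mem : ⊤ ∈ p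
  bot_notMem : ⊥ ∉ p
  mem_of_le : ∀ {a b}, a ≤ b → a ∈ p → b ∈ p
  inf_mem : ∀ {a b}, a ∈ p → b ∈ p → a ⊓ b ∈ p
  round : ∀ {a}, a ∈ p → ∃ b ∈ p, ll b a
  compl_mem_or_mem : ∀ {a b}, ll a b → aᶜ ∈ p ∨ b ∈ p

theorem IsMVDPoint.compl_notMem {ll : B → B → Prop} {p : Set B} (hp : IsMVDPoint ll p) {a : B}
    (ha : a ∈ p) : aᶜ ∉ p := fun h =>
  hp.bot_notMem (by rw [← inf_compl_eq_bot (a := a)]; exact hp.inf_mem ha h)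

/-- Prime ideals missing some bounded element induce points. -/
theorem isMVDPoint_of_isPrime {ll : B → B → Prop} (h : IsMVDAlgebra ll) {I : Order.Ideal B}
    (hI : I.IsPrime) {e : B} (he : ll e ⊤) (heI : e ∉ I) :
    IsMVDPoint ll {a | ∃ b ∉ I, ll b a} where
  top_mem := ⟨e, heI, he⟩
  bot_notMem := by
    rintro ⟨b, hb, hb0⟩
    exact hb (I.lower (h.le_of_ll _ _ hb0) I.bot_mem)
  mem_of_le := by
    rintro a c hac ⟨b, hb, hba⟩
    exact ⟨b, hb, h.mono _ _ _ _ le_rfl hba hac⟩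
  inf_mem := by
    rintro a c ⟨b, hb, hba⟩ ⟨d, hd, hdc⟩
    exact ⟨b ⊓ d, fun hm => (hI.mem_or_mem hm).elim hb hd, h.inf_ll_inf hba hdc⟩
  round := by
    rintro a ⟨b, hb, hba⟩
    obtain ⟨c, hbc, hca⟩ := h.interpolate _ _ hba
    exact ⟨c, ⟨b, hb, hbc⟩, hca⟩
  compl_mem_or_mem := by
    intro a b hab
    obtain ⟨c, hac, hcb⟩ := h.interpolate _ _ hab
    by_cases hc : c ∈ I
    · left
      -- The factor `e` supplies the boundedness that `cᶜ` may lack.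
      refine ⟨e ⊓ cᶜ, fun hm => ?_, h.inf_compl_ll_compl hac he⟩
      rcases hI.mem_or_mem hm with h1 | h1
      · exact heI h1
      · apply hI.toIsProper.top_notMem
        rw [← sup_compl_eq_top (x := c)]
        exact I.sup_mem hc h1
    · exact Or.inr ⟨c, hc, hcb⟩

/-- The space of points of an MVD-algebra. -/
def MVDPoint (ll : B → B → Prop) : Type u := {p : Set B // IsMVDPoint ll p}

namespace MVDPoint

variable {ll : B → B → Prop}

/-- A prime ideal avoiding some nonzero `b ≪ a` induces a point containing `a`. -/
theorem exists_mem (h : IsMVDAlgebra ll) {a : B} (ha : a ≠ ⊥) : ∃ p : MVDPoint ll, a ∈ p.1 := by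
  obtain ⟨b, hb, hba⟩ := h.exists_inside a ha
  have hd : Disjoint ((Order.PFilter.principal b : Order.PFilter B) : Set B)
      ((Order.Ideal.principal ⊥ : Order.Ideal B) : Set B) := by
    rw [Set.disjoint_left]
    intro c hc hc0
    have h0 : c = ⊥ := le_bot_iff.1 (Order.Ideal.mem_principal.1 hc0)
    have hbc : b ≤ c := Order.PFilter.mem_principal.1 hc
    exact hb (le_bot_iff.1 (h0 ▸ hbc))
  obtain ⟨I, hI, -, hbI⟩ := DistribLattice.prime_ideal_of_disjoint_filter_ideal hd
  have hbI' : b ∉ I := fun hm => Set.disjoint_left.1 hbI (Order.PFilter.mem_principal.2 le_rfl) hm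
  exact ⟨⟨_, isMVDPoint_of_isPrime h hI (h.bounded_of_ll hba) hbI'⟩, b, hbI', hba⟩

/-- The set of points containing a given element. -/
def basicOpen (ll : B → B → Prop) (a : B) : Set (MVDPoint ll) := {p | a ∈ p.1}

theorem basicOpen_mono {a b : B} (hab : a ≤ b) : basicOpen ll a ⊆ basicOpen ll b :=
  fun p hp => p.2.mem_of_le hab hp

theorem basicOpen_inf (a b : B) : basicOpen ll (a ⊓ b) = basicOpen ll a ∩ basicOpen ll b := by
  ext p
  exact ⟨fun hp => ⟨p.2.mem_of_le inf_le_left hp, p.2.mem_of_le inf_le_right hp⟩,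
    fun hp => p.2.inf_mem hp.1 hp.2⟩

theorem basicOpen_subset_iff (h : IsMVDAlgebra ll) {a b : B} :
    basicOpen ll a ⊆ basicOpen ll b ↔ a ≤ b := by
  refine ⟨fun hab => ?_, basicOpen_mono⟩
  by_contra hle
  have hne : a ⊓ bᶜ ≠ ⊥ := fun h0 => hle (by
    rw [← compl_compl b]; exact (disjoint_iff.2 h0).le_compl_right)
  obtain ⟨p, hp⟩ := exists_mem h hne
  exact p.2.compl_notMem (hab (p.2.mem_of_le inf_le_left hp)) (p.2.mem_of_le inf_le_right hp)

instance : TopologicalSpace (MVDPoint ll) where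
  IsOpen U := ∀ p ∈ U, ∃ a ∈ p.1, basicOpen ll a ⊆ U
  isOpen_univ p _ := ⟨⊤, p.2.top_mem, Set.subset_univ _⟩
  isOpen_inter U V hU hV := by
    rintro p ⟨hpU, hpV⟩
    obtain ⟨a, ha, haU⟩ := hU p hpU
    obtain ⟨b, hb, hbV⟩ := hV p hpV
    refine ⟨a ⊓ b, p.2.inf_mem ha hb, ?_⟩
    rw [basicOpen_inf]
    exact Set.inter_subset_inter haU hbV
  isOpen_sUnion S hS := by
    rintro p ⟨U, hUS, hpU⟩
    obtain ⟨a, ha, haU⟩ := hS U hUS p hpU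
    exact ⟨a, ha, haU.trans (Set.subset_sUnion_of_mem hUS)⟩

theorem isOpen_iff {U : Set (MVDPoint ll)} :
    IsOpen U ↔ ∀ p ∈ U, ∃ a ∈ p.1, basicOpen ll a ⊆ U := Iff.rfl

theorem isOpen_basicOpen (a : B) : IsOpen (basicOpen ll a) :=
  isOpen_iff.2 fun _ hp => ⟨a, hp, subset_rfl⟩

theorem mem_nhds_iff {p : MVDPoint ll} {U : Set (MVDPoint ll)} :
    U ∈ nhds p ↔ ∃ a ∈ p.1, basicOpen ll a ⊆ U := by
  rw [_root_.mem_nhds_iff]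
  constructor
  · rintro ⟨V, hVU, hV, hpV⟩
    obtain ⟨a, ha, haV⟩ := isOpen_iff.1 hV p hpV
    exact ⟨a, ha, haV.trans hVU⟩
  · rintro ⟨a, ha, haU⟩
    exact ⟨_, haU, isOpen_basicOpen a, ha⟩

theorem mem_closure_basicOpen (h : IsMVDAlgebra ll) {a : B} {p : MVDPoint ll} :
    p ∈ closure (basicOpen ll a) ↔ aᶜ ∉ p.1 := by
  rw [mem_closure_iff_nhds]
  constructor
  · intro hp hap
    obtain ⟨q, hq, hqa⟩ := hp _ (mem_nhds_iff.2 ⟨_, hap, subset_rfl⟩)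
    exact q.2.compl_notMem hqa hq
  · intro hp U hU
    obtain ⟨b, hb, hbU⟩ := mem_nhds_iff.1 hU
    have hne : b ⊓ a ≠ ⊥ := fun h0 =>
      hp (p.2.mem_of_le (disjoint_iff.2 h0).le_compl_right hb)
    obtain ⟨q, hq⟩ := exists_mem h hne
    exact ⟨q, hbU (q.2.mem_of_le inf_le_left hq), q.2.mem_of_le inf_le_right hq⟩

theorem closure_basicOpen (h : IsMVDAlgebra ll) (a : B) :
    closure (basicOpen ll a) = (basicOpen ll aᶜ)ᶜ :=
  Set.ext fun _ => mem_closure_basicOpen h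

theorem interior_closure_basicOpen (h : IsMVDAlgebra ll) (a : B) :
    interior (closure (basicOpen ll a)) = basicOpen ll a := by
  rw [closure_basicOpen h, interior_compl, closure_basicOpen h, compl_compl, compl_compl]

theorem closure_basicOpen_subset (h : IsMVDAlgebra ll) {a b : B} (hab : ll a b) :
    closure (basicOpen ll a) ⊆ basicOpen ll b := fun p hp =>
  (p.2.compl_mem_or_mem hab).resolve_left ((mem_closure_basicOpen h).1 hp)

theorem basicOpen_bot : basicOpen ll ⊥ = ∅ :=
  Set.eq_empty_of_forall_notMem fun p => p.2.bot_notMem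

/-- This point is the limit of `F`, which gives compactness of closures of bounded basic open sets.
-/
theorem isMVDPoint_of_ultrafilter (h : IsMVDAlgebra ll) (F : Ultrafilter (MVDPoint ll)) {e : B}
    (he : ll e ⊤) (heF : closure (basicOpen ll e) ∈ F) :
    IsMVDPoint ll {b | ∃ c, basicOpen ll c ∈ F ∧ ll c b} := by
  obtain ⟨e', hee', he'⟩ := h.interpolate _ _ he
  have he'F : basicOpen ll e' ∈ F := Filter.mem_of_superset heF (closure_basicOpen_subset h hee')
  constructor
  · exact ⟨e', he'F, he'⟩
  · rintro ⟨c, hc, hc0⟩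
    rw [le_bot_iff.1 (h.le_of_ll _ _ hc0), basicOpen_bot] at hc
    exact F.empty_notMem hc
  · rintro a b hab ⟨c, hc, hca⟩
    exact ⟨c, hc, h.mono _ _ _ _ le_rfl hca hab⟩
  · rintro a b ⟨c, hc, hca⟩ ⟨d, hd, hdb⟩
    refine ⟨c ⊓ d, ?_, h.inf_ll_inf hca hdb⟩
    rw [basicOpen_inf]
    exact Filter.inter_mem hc hd
  · rintro a ⟨c, hc, hca⟩
    obtain ⟨d, hcd, hda⟩ := h.interpolate _ _ hca
    exact ⟨d, ⟨c, hc, hcd⟩, hda⟩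
  · intro a b hab
    obtain ⟨c, hac, hcb⟩ := h.interpolate _ _ hab
    -- A second interpolant is needed: if the basic open set of `d` is not in `F`, then that of `cᶜ`
    -- is, since it contains the complement of the former.
    obtain ⟨d, hcd, hdb⟩ := h.interpolate _ _ hcb
    by_cases hd : basicOpen ll d ∈ F
    · exact Or.inr ⟨d, hd, hdb⟩
    · left
      refine ⟨e' ⊓ cᶜ, ?_, h.inf_compl_ll_compl hac he'⟩
      rw [basicOpen_inf]
      refine Filter.inter_mem he'F
        (Filter.mem_of_superset (Ultrafilter.compl_mem_iff_notMem.2 hd) ?_)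
      rw [Set.compl_subset_comm, ← closure_basicOpen h]
      exact closure_basicOpen_subset h hcd

theorem isCompact_closure_basicOpen (h : IsMVDAlgebra ll) {a : B} (ha : ll a ⊤) :
    IsCompact (closure (basicOpen ll a)) := by
  rw [isCompact_iff_ultrafilter_le_nhds']
  intro F hF
  let p : MVDPoint ll := ⟨_, isMVDPoint_of_ultrafilter h F ha hF⟩
  have hp : (F : Filter (MVDPoint ll)) ≤ nhds p := by
    intro U hU
    obtain ⟨b, ⟨c, hc, hcb⟩, hbU⟩ := mem_nhds_iff.1 hU
    exact Filter.mem_of_superset hc ((basicOpen_mono (h.le_of_ll _ _ hcb)).trans hbU)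
  exact ⟨p, isClosed_closure.mem_of_tendsto (f := id) hp hF, hp⟩

/-- For the converse, roundness covers the compact closure by basic open sets of elements `c ≪ b`;
finitely many suffice, and their join is still `≪ b`. -/
theorem ll_iff (h : IsMVDAlgebra ll) {a b : B} :
    ll a b ↔ IsCompact (closure (basicOpen ll a)) ∧ closure (basicOpen ll a) ⊆ basicOpen ll b := by
  refine ⟨fun hab => ⟨isCompact_closure_basicOpen h (h.bounded_of_ll hab),
    closure_basicOpen_subset h hab⟩, ?_⟩
  rintro ⟨hK, hab⟩
  have hc : ∃ c, ll c b ∧ closure (basicOpen ll a) ⊆ basicOpen ll c := by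
    refine hK.induction_on ⟨⊥, h.bot_ll b, Set.empty_subset _⟩ ?_ ?_ ?_
    · rintro s t hst ⟨c, hcb, htc⟩
      exact ⟨c, hcb, hst.trans htc⟩
    · rintro s t ⟨c, hcb, hsc⟩ ⟨d, hdb, htd⟩
      exact ⟨c ⊔ d, h.sup_ll _ _ _ hcb hdb, Set.union_subset
        (hsc.trans (basicOpen_mono le_sup_left)) (htd.trans (basicOpen_mono le_sup_right))⟩
    · intro p hp
      obtain ⟨c, hc, hcb⟩ := p.2.round (hab hp)
      exact ⟨_, mem_nhdsWithin_of_mem_nhds (mem_nhds_iff.2 ⟨c, hc, subset_rfl⟩), c, hcb, subset_rfl⟩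
  obtain ⟨c, hcb, hac⟩ := hc
  exact h.mono _ _ _ _ ((basicOpen_subset_iff h).1 (subset_closure.trans hac)) hcb le_rfl

theorem exists_disjoint_basicOpen {p q : MVDPoint ll} {a : B} (hap : a ∈ p.1) (haq : a ∉ q.1) :
    ∃ b ∈ p.1, bᶜ ∈ q.1 := by
  obtain ⟨b, hb, hba⟩ := p.2.round hap
  exact ⟨b, hb, (q.2.compl_mem_or_mem hba).resolve_right haq⟩

instance : T2Space (MVDPoint ll) where
  t2 p q hpq := by
    have hd (b : B) : Disjoint (basicOpen ll b) (basicOpen ll bᶜ) :=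
      Set.disjoint_left.2 fun r hr => r.2.compl_notMem hr
    by_cases hle : p.1 ⊆ q.1
    · have hne : ¬ q.1 ⊆ p.1 := fun hle' => hpq (Subtype.ext (hle.antisymm hle'))
      obtain ⟨a, haq, hap⟩ := Set.not_subset.1 hne
      obtain ⟨b, hbq, hbp⟩ := exists_disjoint_basicOpen haq hap
      exact ⟨_, _, isOpen_basicOpen _, isOpen_basicOpen _, hbp, hbq, (hd b).symm⟩
    · obtain ⟨a, hap, haq⟩ := Set.not_subset.1 hle
      obtain ⟨b, hbp, hbq⟩ := exists_disjoint_basicOpen hap haq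
      exact ⟨_, _, isOpen_basicOpen _, isOpen_basicOpen _, hbp, hbq, hd b⟩

theorem locallyCompactSpace (h : IsMVDAlgebra ll) : LocallyCompactSpace (MVDPoint ll) where
  local_compact_nhds p U hU := by
    obtain ⟨a, ha, haU⟩ := mem_nhds_iff.1 hU
    obtain ⟨b, hb, hba⟩ := p.2.round ha
    exact ⟨_, mem_nhds_iff.2 ⟨b, hb, subset_closure⟩,
      (closure_basicOpen_subset h hba).trans haU,
      isCompact_closure_basicOpen h (h.bounded_of_ll hba)⟩

/-- The regular open set of points containing a given element. -/
def basicRegularOpen (h : IsMVDAlgebra ll) (a : B) : RegularOpens (MVDPoint ll) :=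
  ⟨⟨basicOpen ll a, isOpen_basicOpen a⟩,
    (RegularOpens.isRegular_iff _).2 (interior_closure_basicOpen h a)⟩

end MVDPoint

end Points

/-! ### Representation of complete MVD-algebras; essential surjectivity. -/

section Representation

variable {B : Type u} [CompleteBooleanAlgebra B] {ll : B → B → Prop}

namespace MVDPoint

/-- Completeness enters here: the witness is the join of all elements whose basic open set lies in
`U`. By infinite distributivity anything meeting this join meets one of those elements, so its basic
open set lies in the closure of `U`, hence in `U` by regularity. -/
theorem exists_basicRegularOpen_eq (h : IsMVDAlgebra ll) (U : RegularOpens (MVDPoint ll)) :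
    ∃ a, basicRegularOpen h a = U := by
  refine ⟨sSup {b | basicOpen ll b ⊆ U}, SetLike.coe_injective ?_⟩
  apply subset_antisymm
  · refine (interior_maximal (fun p hp => ?_) (isOpen_basicOpen _)).trans_eq U.interior_closure
    rw [mem_closure_iff_nhds]
    intro V hV
    obtain ⟨c, hc, hcV⟩ := mem_nhds_iff.1 hV
    have hne : c ⊓ sSup {b | basicOpen ll b ⊆ U} ≠ ⊥ := fun h0 =>
      p.2.bot_notMem (h0 ▸ p.2.inf_mem hc hp)
    obtain ⟨b, hbU, hb⟩ : ∃ b, basicOpen ll b ⊆ U ∧ c ⊓ b ≠ ⊥ := by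
      by_contra! hn
      rw [inf_sSup_eq] at hne
      exact hne (by simpa using hn)
    obtain ⟨q, hq⟩ := exists_mem h hb
    exact ⟨q, hcV (q.2.mem_of_le inf_le_left hq), hbU (q.2.mem_of_le inf_le_right hq)⟩
  · intro p hp
    obtain ⟨b, hb, hbU⟩ := isOpen_iff.1 U.isOpen p hp
    exact p.2.mem_of_le (le_sSup hbU) hb

/-- A complete MVD-algebra is isomorphic to the algebra of regular open sets of its points. -/
noncomputable def orderIsoRegularOpens (h : IsMVDAlgebra ll) :
    B ≃o RegularOpens (MVDPoint ll) :=
  (RelIso.ofSurjective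
    (OrderEmbedding.ofMapLEIff (basicRegularOpen h) fun _ _ => basicOpen_subset_iff h)
    (exists_basicRegularOpen_eq h))

theorem compactlyInside_orderIsoRegularOpens (h : IsMVDAlgebra ll) (a b : B) :
    RegularOpens.CompactlyInside (orderIsoRegularOpens h a) (orderIsoRegularOpens h b) ↔ ll a b :=
  (ll_iff h).symm

end MVDPoint

theorem lowerAdjoint_orderIso {A : Type u} [CompleteBooleanAlgebra A] (e : A ≃o B) (b : B) :
    lowerAdjoint (e : CompleteLatticeHom A B) b = e.symm b := by
  apply eq_of_forall_ge_iff
  intro a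
  rw [lowerAdjoint_gc]
  exact e.symm_apply_le.symm

theorem isIOAMorphism_orderIso {A : Type u} [CompleteBooleanAlgebra A] {kk : A → A → Prop}
    (e : A ≃o B) (he : ∀ a b, ll (e a) (e b) ↔ kk a b) :
    IsIOAMorphism kk ll (e : CompleteLatticeHom A B) where
  S1 a b hab d hd := by
    obtain ⟨c, rfl⟩ := e.surjective d
    have hc : kk c ⊤ := (he _ _).1 (by rwa [map_top])
    have h1 := (he _ _).2 (hab c hc)
    rwa [map_inf, map_sup, map_compl'] at h1
  S2 b hb := by
    rw [lowerAdjoint_orderIso, ← he, e.apply_symm_apply, map_top]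
    exact hb
  SO a b hb := by
    rw [lowerAdjoint_orderIso, ← he, e.apply_symm_apply]
    exact hb

/-- Order isomorphisms preserving and reflecting `≪` are isomorphisms in IOA. -/
def IOA.isoOfOrderIso (X Y : IOA.{u}) (e : X.carrier ≃o Y.carrier)
    (he : ∀ a b, Y.ll (e a) (e b) ↔ X.ll a b) : X ≅ Y where
  hom := ⟨(e : CompleteLatticeHom X.carrier Y.carrier), isIOAMorphism_orderIso e he⟩
  inv := ⟨(e.symm : CompleteLatticeHom Y.carrier X.carrier),
    isIOAMorphism_orderIso e.symm fun a b => by simp [← he]⟩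
  hom_inv_id := IOA.Hom.ext (CompleteLatticeHom.ext fun a => e.symm_apply_apply a)
  inv_hom_id := IOA.Hom.ext (CompleteLatticeHom.ext fun a => e.apply_symm_apply a)

instance : olcToIoa.{u}.EssSurj where
  mem_essImage X := by
    have := MVDPoint.locallyCompactSpace X.isMVD
    exact ⟨Opposite.op ⟨MVDPoint X.ll⟩, ⟨(IOA.isoOfOrderIso X
      ⟨RegularOpens (MVDPoint X.ll), RegularOpens.CompactlyInside, RegularOpens.isMVDAlgebra⟩
      (MVDPoint.orderIsoRegularOpens X.isMVD)
      (MVDPoint.compactlyInside_orderIsoRegularOpens X.isMVD)).symm⟩⟩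

end Representation

/-! ### Every IOA-morphism comes from a unique continuous open map. -/

section Realisation

namespace RegularOpens

variable {X Y : Type u} [TopologicalSpace X] [T2Space X] [LocallyCompactSpace X]
  [TopologicalSpace Y] [T2Space Y] [LocallyCompactSpace Y]

/-- Roundness puts a relatively compact `U` in `p`. Were there no common point of the closures,
compactness would give a member of `p` disjoint from `U`. Roundness then upgrades closures to the
sets themselves, and the primeness condition gives the converse. -/
theorem exists_mem_iff_of_isMVDPoint {p : Set (RegularOpens Y)}
    (hp : IsMVDPoint CompactlyInside p) : ∃ y : Y, ∀ V : RegularOpens Y, V ∈ p ↔ y ∈ V := by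
  obtain ⟨U, hU, hUc, -⟩ := hp.round hp.top_mem
  have hy : ∃ y, ∀ V ∈ p, y ∈ closure (V : Set Y) := by
    by_contra! hn
    have hs : ∃ V ∈ p, Disjoint (V : Set Y) (closure (U : Set Y)) := by
      refine hUc.induction_on ⟨U, hU, Set.disjoint_empty _⟩ ?_ ?_ ?_
      · rintro s t hst ⟨V, hV, hVt⟩
        exact ⟨V, hV, hVt.mono_right hst⟩
      · rintro s t ⟨V, hV, hVs⟩ ⟨W, hW, hWt⟩
        exact ⟨V ⊓ W, hp.inf_mem hV hW, Set.disjoint_union_right.2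
          ⟨hVs.mono_left Set.inter_subset_left, hWt.mono_left Set.inter_subset_right⟩⟩
      · intro y _
        obtain ⟨V, hV, hyV⟩ := hn y
        exact ⟨_, mem_nhdsWithin_of_mem_nhds (isClosed_closure.isOpen_compl.mem_nhds hyV), V, hV,
          Set.disjoint_compl_right_iff_subset.2 subset_closure⟩
    obtain ⟨V, hV, hVU⟩ := hs
    refine hp.bot_notMem ?_
    have h0 : V ⊓ U = ⊥ := SetLike.coe_injective
      (Set.disjoint_iff_inter_eq_empty.1 (hVU.mono_right subset_closure))
    exact h0 ▸ hp.inf_mem hV hU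
  obtain ⟨y, hy⟩ := hy
  refine ⟨y, fun V => ⟨fun hV => ?_, fun hV => ?_⟩⟩
  · obtain ⟨W, hW, hWV⟩ := hp.round hV
    exact hWV.2 (hy W hW)
  · obtain ⟨W, hyW, hWV⟩ := exists_mem_compactlyInside hV
    refine (hp.compl_mem_or_mem hWV).resolve_left fun hW => ?_
    have h1 := hy _ hW
    rw [coe_compl, closure_compl, interior_closure] at h1
    exact h1 hyW

variable {φ : CompleteLatticeHom (RegularOpens Y) (RegularOpens X)}

/-- Roundness comes from (SO), applied to a relatively compact neighbourhood of `x`; the primeness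
condition comes from (S1). -/
theorem isMVDPoint_of_isIOAMorphism (hφ : IsIOAMorphism CompactlyInside CompactlyInside φ)
    (x : X) : IsMVDPoint CompactlyInside {V : RegularOpens Y | x ∈ φ V} where
  top_mem := by
    rw [Set.mem_ofPred_eq, map_top]
    exact mem_top x
  bot_notMem := by
    rw [Set.mem_ofPred_eq, map_bot]
    exact notMem_bot x
  mem_of_le hab hx := OrderHomClass.mono φ hab hx
  inf_mem ha hb := by
    rw [Set.mem_ofPred_eq, map_inf]
    exact ⟨ha, hb⟩
  round hx := by
    obtain ⟨U, hxU, hU⟩ := exists_mem_compactlyInside hx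
    exact ⟨_, (lowerAdjoint_gc φ).le_u_l U hxU, hφ.SO _ _ hU⟩
  compl_mem_or_mem {V W} hVW := by
    have h1 := hφ.S1 V W ((closure_subset_iff _ _).1 hVW.2)
    rw [← closure_subset_iff] at h1
    by_cases hx : x ∈ closure (φ V : Set X)
    · exact Or.inr (h1 hx)
    · left
      rw [Set.mem_ofPred_eq, φ.map_compl_eq, mem_compl]
      exact hx

theorem exists_continuousOpenMap (hφ : IsIOAMorphism CompactlyInside CompactlyInside φ) :
    ∃ f : X →CO Y, preimageHom f = φ := by
  choose f hf using fun x => exists_mem_iff_of_isMVDPoint (isMVDPoint_of_isIOAMorphism hφ x)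
  have hpre (V : RegularOpens Y) : f ⁻¹' (V : Set Y) = φ V :=
    Set.ext fun x => (hf x V).symm
  have hcont : Continuous f := by
    rw [continuous_def]
    intro U hU
    rw [isOpen_iff_mem_nhds]
    intro x hx
    obtain ⟨V, hxV, -, hVU⟩ := exists_mem_subset hU hx
    refine Filter.mem_of_superset ((φ V).isOpen.mem_nhds ((hf x V).2 hxV)) ?_
    rw [← hpre]
    exact Set.preimage_mono (subset_closure.trans hVU)
  have hopen : IsOpenMap f := by
    intro U hU
    rw [isOpen_iff_mem_nhds]
    rintro _ ⟨x, hx, rfl⟩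
    obtain ⟨W, hxW, hW, hWU⟩ := exists_mem_subset hU hx
    have hWφ : W ≤ φ (lowerAdjoint φ W) := (lowerAdjoint_gc φ).le_u_l W
    refine Filter.mem_of_superset
      ((lowerAdjoint φ W).isOpen.mem_nhds ((hf x _).1 (hWφ hxW))) ?_
    -- It remains to see that the lower adjoint of `W` lies in `f '' closure W`: a point off this
    -- compact set has a regular open neighbourhood `V` with `W ≤ φ Vᶜ`, so the lower adjoint lies
    -- in `Vᶜ`.
    refine subset_trans ?_ (Set.image_mono hWU)
    intro y hy
    by_contra hyW
    obtain ⟨V, hyV, -, hV⟩ := exists_mem_subset (hW.image hcont).isClosed.isOpen_compl hyW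
    have h1 : W ≤ φ Vᶜ := by
      rw [φ.map_compl_eq]
      refine le_iff_subset.2 fun z hz => mem_compl.2 ?_
      rw [← hpre]
      intro hzV
      exact hV (hcont.closure_preimage_subset _ hzV) (Set.mem_image_of_mem f (subset_closure hz))
    exact mem_compl.1 ((lowerAdjoint_gc φ _ _).2 h1 hy) (subset_closure hyV)
  exact ⟨⟨⟨f, hcont⟩, hopen⟩, CompleteLatticeHom.ext fun V => SetLike.coe_injective (hpre V)⟩

end RegularOpens

instance : olcToIoa.{u}.Full where
  map_surjective {X Y} φ := by
    obtain ⟨f, hf⟩ := RegularOpens.exists_continuousOpenMap φ.isIOA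
    exact ⟨Quiver.Hom.op (⟨f⟩ : OLC.Hom Y.unop X.unop), IOA.Hom.ext hf⟩

instance : olcToIoa.{u}.Faithful where
  map_injective {X Y} f g hfg := by
    apply Quiver.Hom.unop_inj
    refine OLC.Hom.ext (ContinuousOpenMap.ext fun y => ?_)
    refine RegularOpens.eq_of_forall_mem fun U hU => ?_
    have h1 := congrArg (fun φ : IOA.Hom _ _ => φ.toMap U) hfg
    have h2 : RegularOpens.preimage f.unop.toMap U = RegularOpens.preimage g.unop.toMap U := h1
    have h3 : y ∈ RegularOpens.preimage f.unop.toMap U := hU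
    rw [h2] at h3
    exact h3

instance : olcToIoa.{u}.IsEquivalence where

end Realisation

/-- The categories OAL and IOA are isomorphic (in the category of categories), and the category
OLC of locally compact Hausdorff spaces and open maps is dually equivalent to IOA. -/
theorem mainTheorem4 :
    Nonempty (Cat.of OAL.{u} ≅ Cat.of IOA.{u}) ∧ Nonempty (OLC.{u}ᵒᵖ ≌ IOA.{u}) :=
  ⟨⟨oalIsoIoa⟩, ⟨olcToIoa.asEquivalence⟩⟩
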